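/- Let $n\ge 2$ and let $\zeta_1,\dots,\zeta_{n-1}$ be arbitrary (not necessarily distinct) points of the open upper half-plane $\{z\in\mathbb C:\operatorname{Im}z>0\}$. (i) The system $$\sum_{\substack{j=1\\ j\ne k}}^{n-1}\frac{2}{t_k-t_j}-\sum_{j=1}^{n-1}\left(\frac1{t_k-\zeta_j}+\frac1{t_k-\overline{\zeta}_j}\right)=0,\qquad k=1,\dots,n-1,$$ has a unique real solution with $t_1<t_2<\dots<t_{n-1}$. On the set of all $(n-1)$-tuples of pairwise distinct real numbers, this solution is a global minimiser of the energy $$W(t_1,\dots,t_{n-1})=\sum_{1\le k,j\le n-1}\log\bigl|(t_k-\zeta_j)(t_k-\overline{\zeta}_j)\bigr|-2\sum_{1\le k<j\le n-1}\log|t_j-t_k|,$$ and, up to a rearrangement of the $t_k$, it is the only global minimiser and the only critical point of $W$. (ii) Let $t_1<\dots<t_{n-1}$ be the solution in (i), put $t_0:=-\infty$ and $t_n:=+\infty$, and fix $k_0\in\{1,\dots,n\}$. For every real $x_{k_0}\in(t_{k_0-1},t_{k_0})$ there are unique real points $x_k\in(t_{k-1},t_k)$, $k\in\{1,\dots,n\}\setminus\{k_0\}$,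 such that $$\sum_{\substack{j=1\\ j\ne k}}^{n}\frac{2}{x_k-x_j}-\sum_{j=1}^{n-1}\left(\frac1{x_k-\zeta_j}+\frac1{x_k-\overline{\zeta}_j}\right)=0,\qquad k=1,\dots,n.$$ Each $x_k$ is a continuous and strictly increasing function of $x_{k_0}\in(t_{k_0-1},t_{k_0})$. For every $k$, $x_k\to t_{k-1}$ as $x_{k_0}\to t_{k_0-1}$, and $x_k\to t_k$ as $x_{k_0}\to t_{k_0}$. -/

import Mathlib

open Filter Topology

namespace BlaschkeEquilibrium

/-- Unit charges at the real positions `x`, in the field of charges of size `-1/2` at all the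
points `ζ j` and their conjugates, are in equilibrium: for every `k`,
`∑_{j ≠ k} 2 / (x k - x j) - ∑_j (1 / (x k - ζ j) + 1 / (x k - conj (ζ j))) = 0`.
It is only used for tuples `x` with pairwise distinct entries. -/
def IsEquilibrium {m n : ℕ} (ζ : Fin m → UpperHalfPlane) (x : Fin n → ℝ) : Prop :=
  ∀ k : Fin n,
    (∑ j ∈ Finset.univ.erase k, 2 / ((x k : ℂ) - (x j : ℂ)))
      - ∑ j : Fin m, (1 / ((x k : ℂ) - (ζ j : ℂ))
          + 1 / ((x k : ℂ) - (starRingEnd ℂ) (ζ j : ℂ))) = 0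

/-- The potential energy of unit charges at the pairwise distinct real positions `t`. -/
noncomputable def energy {m : ℕ} (ζ : Fin m → UpperHalfPlane) (t : Fin m → ℝ) : ℝ :=
  (∑ k : Fin m, ∑ j : Fin m,
      Real.log ‖((t k : ℂ) - (ζ j : ℂ)) * ((t k : ℂ) - (starRingEnd ℂ) (ζ j : ℂ))‖)
    - 2 * ∑ k : Fin m, ∑ j ∈ Finset.Ioi k, Real.log |t j - t k|

/-- The natural domain of the energy: tuples of pairwise distinct real numbers. -/
def configurations (m : ℕ) : Set (Fin m → ℝ) := {t | Function.Injective t}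

/-- A critical point of the energy: a point of its domain where the total derivative exists
and vanishes. -/
def IsCriticalPoint {m : ℕ} (ζ : Fin m → UpperHalfPlane) (t : Fin m → ℝ) : Prop :=
  t ∈ configurations m ∧ HasFDerivAt (energy ζ) (0 : (Fin m → ℝ) →L[ℝ] ℝ) t

/-- The list `-∞, t 0, …, t (m - 1), +∞` of extended real numbers. -/
noncomputable def nodes {m : ℕ} (t : Fin m → ℝ) : Fin (m + 2) → EReal :=
  Fin.cons (⊥ : EReal) (Fin.snoc (fun i : Fin m => (t i : EReal)) (⊤ : EReal) :
    Fin (m + 1) → EReal)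

/-- The `k`-th (counted from `0`) of the `m + 1` open intervals of the real line that are bounded
by consecutive nodes. -/
noncomputable def gap {m : ℕ} (t : Fin m → ℝ) (k : Fin (m + 1)) : Set ℝ :=
  {x : ℝ | nodes t k.castSucc < (x : EReal) ∧ (x : EReal) < nodes t k.succ}

/-- The filter on `ℝ` of points of the `k`-th gap that tend to its left endpoint
(which is `-∞` for the first gap). -/
noncomputable def toLeftEnd {m : ℕ} (t : Fin m → ℝ) (k : Fin (m + 1)) : Filter ℝ :=
  comap (fun x : ℝ => (x : EReal)) (𝓝 (nodes t k.castSucc)) ⊓ 𝓟 (gap t k)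

/-- The filter on `ℝ` of points of the `k`-th gap that tend to its right endpoint
(which is `+∞` for the last gap). -/
noncomputable def toRightEnd {m : ℕ} (t : Fin m → ℝ) (k : Fin (m + 1)) : Filter ℝ :=
  comap (fun x : ℝ => (x : EReal)) (𝓝 (nodes t k.succ)) ⊓ 𝓟 (gap t k)

/-- `x` is a solution of the equilibrium system for `m + 1` charges, with one charge in each gap. -/
def IsInterlacingSolution {m : ℕ} (ζ : Fin m → UpperHalfPlane) (t : Fin m → ℝ)
    (x : Fin (m + 1) → ℝ) : Prop :=
  (∀ k, x k ∈ gap t k) ∧ IsEquilibrium ζ x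

end BlaschkeEquilibrium

namespace BlaschkeEquilibrium

open Polynomial Finset

/-! Let F be `fieldPoly ζ`: it has degree 2m, is monic, and is positive on the real line. A charge
at `x k` is in equilibrium exactly when F and the square of the Lagrange basis polynomial ℓ_k have
equal logarithmic derivatives there. Hence x is an equilibrium iff F and Σ F(x_k) ℓ_k² agree to
second order at all nodes, and comparing degrees turns this into an identity: F = Σ F(x_k) ℓ_k² for
m + 1 charges, F = N² + Σ F(t_k) ℓ_k² for m charges, where N = ∏ (X - t_k) (`fieldPoly_eq_sum`,
`fieldPoly_eq_sq_add_sum`).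

Uniqueness is linear algebra. The values of one Lagrange basis at the nodes of another form mutually
inverse matrices; the two sums of squares bound their weighted column norms, and this forces the
matrices to be weighted transposes of each other (`weighted_inverse_eq_transpose`). For m charges
the resulting equality makes N vanish at the other solution; for m + 1 charges a single common point
propagates to all the others.

Existence for m charges: exp(-W), extended by zero to coincident points, is continuous and decays at
infinity, so it attains a positive maximum, and W is critical there.

Existence for m + 1 charges: f(u) = u - Σ a_k / (u - t_k), with a_k = F(t_k) / ∏_{j ≠ k} (t_k -
t_j)², increases from -∞ to +∞ on each gap. By the identity for t, the numerator R of f - c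
satisfies R' N - R N' = F, which makes every level set of f an equilibrium
(`isEquilibrium_of_pickFun_eq`). The solution through u is the level set of f(u), so monotonicity,
continuity and limits are inherited from f and its inverse branches. -/

/-- The real polynomial whose roots are the points `ζ j` and their conjugates. -/
noncomputable def fieldPoly {m : ℕ} (ζ : Fin m → UpperHalfPlane) : ℝ[X] :=
  ∏ j, ((X - C (ζ j).re) ^ 2 + C ((ζ j).im ^ 2))

/-- The monic polynomial with roots `x j`, `j ≠ k`. -/
noncomputable def cofactor {n : ℕ} (x : Fin n → ℝ) (k : Fin n) : ℝ[X] :=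
  Lagrange.nodal (univ.erase k) x

/-- The Lagrange basis polynomial of the nodes `x`. -/
noncomputable def basisPoly {n : ℕ} (x : Fin n → ℝ) (k : Fin n) : ℝ[X] :=
  Lagrange.basis univ x k

lemma eval_derivative_prod {ι : Type*} (s : Finset ι) (f : ι → ℝ[X]) (u : ℝ)
    (h : ∀ i ∈ s, (f i).eval u ≠ 0) :
    (derivative (∏ i ∈ s, f i)).eval u
      = (∏ i ∈ s, f i).eval u * ∑ i ∈ s, (derivative (f i)).eval u / (f i).eval u := by
  classical
  rw [derivative_prod_finset, eval_finsetSum, Finset.mul_sum]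
  refine Finset.sum_congr rfl fun i hi => ?_
  rw [eval_mul, ← Finset.mul_prod_erase s f hi, eval_mul]
  field_simp [h i hi]

/-! ### The field polynomial: positivity, logarithmic derivative, degree. -/

section FieldPoly

variable {m : ℕ} (ζ : Fin m → UpperHalfPlane)

lemma eval_fieldPoly (u : ℝ) :
    (fieldPoly ζ).eval u = ∏ j, ((u - (ζ j).re) ^ 2 + (ζ j).im ^ 2) := by
  simp [fieldPoly, eval_prod]

lemma quadratic_pos (z : UpperHalfPlane) (u : ℝ) : 0 < (u - z.re) ^ 2 + z.im ^ 2 := by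
  have := z.im_pos
  positivity

lemma eval_fieldPoly_pos (u : ℝ) : 0 < (fieldPoly ζ).eval u := by
  rw [eval_fieldPoly]
  exact Finset.prod_pos fun j _ => quadratic_pos _ _

lemma eval_derivative_fieldPoly (u : ℝ) :
    (derivative (fieldPoly ζ)).eval u = (fieldPoly ζ).eval u *
      ∑ j, 2 * (u - (ζ j).re) / ((u - (ζ j).re) ^ 2 + (ζ j).im ^ 2) := by
  have h := eval_derivative_prod univ
    (fun j => ((X - C (ζ j).re) ^ 2 + C ((ζ j).im ^ 2) : ℝ[X])) u
    (fun j _ => by simpa using (quadratic_pos (ζ j) u).ne')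
  rw [fieldPoly, h]
  congr 1
  refine Finset.sum_congr rfl fun j _ => ?_
  simp [derivative_pow, -map_pow]

lemma monic_factor (a b : ℝ) : ((X - C a) ^ 2 + C b : ℝ[X]).Monic ∧
    ((X - C a) ^ 2 + C b : ℝ[X]).natDegree = 2 := by
  have h1 : ((X - C a) ^ 2 : ℝ[X]).Monic := (monic_X_sub_C a).pow 2
  have h2 : ((X - C a) ^ 2 : ℝ[X]).natDegree = 2 := by simp
  constructor
  · refine h1.add_of_left ?_
    refine lt_of_le_of_lt degree_C_le ?_
    rw [degree_eq_natDegree h1.ne_zero, h2]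
    norm_num
  · rw [natDegree_add_C, h2]

lemma monic_fieldPoly : (fieldPoly ζ).Monic :=
  monic_prod_of_monic _ _ fun _ _ => (monic_factor _ _).1

lemma natDegree_fieldPoly : (fieldPoly ζ).natDegree = 2 * m := by
  rw [fieldPoly, natDegree_prod_of_monic _ _ fun _ _ => (monic_factor _ _).1,
    Finset.sum_congr rfl fun _ _ => (monic_factor _ _).2]
  simp [mul_comm]

end FieldPoly

/-! ### Lagrange bases and double vanishing at the nodes. -/

section Nodes

variable {n : ℕ} {x : Fin n → ℝ}

lemma nodal_eq_mul_cofactor (x : Fin n → ℝ) (k : Fin n) :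
    Lagrange.nodal univ x = (X - C (x k)) * cofactor x k :=
  Lagrange.nodal_eq_mul_nodal_erase (mem_univ k)

lemma eval_cofactor_self_ne_zero (hx : Function.Injective x) (k : Fin n) :
    (cofactor x k).eval (x k) ≠ 0 := by
  rw [cofactor, Lagrange.eval_nodal, Finset.prod_ne_zero_iff]
  intro j hj h
  exact (Finset.ne_of_mem_erase hj) (hx (sub_eq_zero.1 h)).symm

lemma eval_derivative_cofactor (hx : Function.Injective x) (k : Fin n) :
    (derivative (cofactor x k)).eval (x k)
      = (cofactor x k).eval (x k) * ∑ j ∈ univ.erase k, 1 / (x k - x j) := by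
  have h := eval_derivative_prod (univ.erase k) (fun j => (X - C (x j) : ℝ[X])) (x k) (by
    intro j hj h
    simp only [eval_sub, eval_X, eval_C] at h
    exact (Finset.ne_of_mem_erase hj) (hx (sub_eq_zero.1 h)).symm)
  rw [cofactor, Lagrange.nodal_eq, h]
  simp

lemma eval_basisPoly_self (hx : Function.Injective x) (k : Fin n) :
    (basisPoly x k).eval (x k) = 1 :=
  Lagrange.eval_basis_self hx.injOn (mem_univ k)

lemma eval_basisPoly_of_ne {j k : Fin n} (h : k ≠ j) : (basisPoly x k).eval (x j) = 0 :=
  Lagrange.eval_basis_of_ne h (mem_univ j)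

lemma basisPoly_eq (x : Fin n → ℝ) (k : Fin n) :
    basisPoly x k = C ((cofactor x k).eval (x k))⁻¹ * cofactor x k := by
  have h := Lagrange.basis_eq_prod_sub_inv_mul_nodal_div (s := univ) (v := x) (mem_univ k)
  rw [← Lagrange.nodal_erase_eq_nodal_div (mem_univ k),
    Lagrange.nodalWeight_eq_eval_nodal_erase_inv] at h
  exact h

lemma natDegree_basisPoly (hx : Function.Injective x) (k : Fin n) :
    (basisPoly x k).natDegree = n - 1 := by
  have := Lagrange.natDegree_basis (s := univ) hx.injOn (mem_univ k)
  simpa [basisPoly] using this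

lemma degree_basisPoly_lt (hx : Function.Injective x) (k : Fin n) :
    (basisPoly x k).degree < n := by
  have h := Lagrange.degree_basis (s := univ) hx.injOn (mem_univ k)
  rw [basisPoly, h]
  have : 0 < n := Fin.pos k
  simp only [card_univ, Fintype.card_fin]
  exact_mod_cast Nat.sub_lt this one_pos

lemma sum_eval_mul_eval_basisPoly (hx : Function.Injective x) {f : ℝ[X]} (hf : f.degree < n)
    (u : ℝ) : ∑ j, f.eval (x j) * (basisPoly x j).eval u = f.eval u := by
  have h := Lagrange.eq_interpolate (s := univ) (v := x) hx.injOn (f := f) (by simpa using hf)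
  conv_rhs => rw [h, Lagrange.interpolate_apply, eval_finsetSum]
  simp [basisPoly]

lemma sq_X_sub_C_dvd {E : ℝ[X]} {a : ℝ} (h0 : E.eval a = 0) (h1 : (derivative E).eval a = 0) :
    (X - C a) ^ 2 ∣ E := by
  obtain ⟨q, rfl⟩ := dvd_iff_isRoot.2 h0
  have h2 : q.eval a = 0 := by simpa [derivative_mul] using h1
  obtain ⟨r, rfl⟩ := dvd_iff_isRoot.2 h2
  exact ⟨r, by ring⟩

lemma sq_nodal_dvd (hx : Function.Injective x) {E : ℝ[X]} (h0 : ∀ k, E.eval (x k) = 0)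
    (h1 : ∀ k, (derivative E).eval (x k) = 0) : Lagrange.nodal univ x ^ 2 ∣ E := by
  rw [Lagrange.nodal_eq, ← Finset.prod_pow]
  refine Finset.prod_dvd_of_coprime ?_ fun k _ => sq_X_sub_C_dvd (h0 k) (h1 k)
  intro i _ j _ hij
  exact (pairwise_coprime_X_sub_C hx hij).pow

end Nodes

/-! ### Equilibrium as a sum-of-squares identity. -/

section Equilibrium

variable {m n : ℕ} {ζ : Fin m → UpperHalfPlane} {x : Fin n → ℝ}

lemma isEquilibrium_iff_real : IsEquilibrium ζ x ↔ ∀ k,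
    2 * (∑ j ∈ univ.erase k, 1 / (x k - x j))
      - ∑ j, 2 * (x k - (ζ j).re) / ((x k - (ζ j).re) ^ 2 + (ζ j).im ^ 2) = 0 := by
  refine forall_congr' fun k => ?_
  have key : ∀ j, 1 / ((x k : ℂ) - (ζ j : ℂ)) + 1 / ((x k : ℂ) - (starRingEnd ℂ) (ζ j : ℂ))
      = ((2 * (x k - (ζ j).re) / ((x k - (ζ j).re) ^ 2 + (ζ j).im ^ 2) : ℝ) : ℂ) := by
    intro j
    set w : ℂ := (x k : ℂ) - (ζ j : ℂ) with hw
    have hc : (x k : ℂ) - (starRingEnd ℂ) (ζ j : ℂ) = (starRingEnd ℂ) w := by simp [hw]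
    have hre : w.re = x k - (ζ j).re := by simp [hw]
    have him : w.im = -(ζ j).im := by simp [hw]
    have hN : w * (starRingEnd ℂ) w
        = (((x k - (ζ j).re) ^ 2 + (ζ j).im ^ 2 : ℝ) : ℂ) := by
      rw [Complex.mul_conj, Complex.normSq_apply, hre, him]
      push_cast; ring
    have hS : w + (starRingEnd ℂ) w = ((2 * (x k - (ζ j).re) : ℝ) : ℂ) := by
      rw [Complex.add_conj, hre]
    have hw0 : w ≠ 0 := by
      intro h
      have := (ζ j).im_pos
      rw [h] at him
      simp at him
      linarith
    have hw1 : (starRingEnd ℂ) w ≠ 0 := by simpa using hw0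
    rw [hc, Complex.ofReal_div, ← hN, ← hS]
    field_simp
    ring
  simp_rw [key]
  rw [← Complex.ofReal_eq_zero]
  push_cast
  simp only [Finset.mul_sum, mul_one_div]

/-- Clearing denominators in the statement that the logarithmic derivative of the field polynomial
at each node is twice that of the cofactor. -/
lemma isEquilibrium_iff (hx : Function.Injective x) : IsEquilibrium ζ x ↔ ∀ k,
    2 * (derivative (cofactor x k)).eval (x k) * (fieldPoly ζ).eval (x k)
      = (cofactor x k).eval (x k) * (derivative (fieldPoly ζ)).eval (x k) := by
  rw [isEquilibrium_iff_real]
  refine forall_congr' fun k => ?_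
  rw [eval_derivative_cofactor hx, eval_derivative_fieldPoly, ← sub_eq_zero
    (a := 2 * ((cofactor x k).eval (x k) * _) * _)]
  have h1 := eval_cofactor_self_ne_zero hx k
  have h2 := (eval_fieldPoly_pos ζ (x k)).ne'
  constructor
  · intro h
    linear_combination (cofactor x k).eval (x k) * (fieldPoly ζ).eval (x k) * h
  · intro h
    refine (mul_eq_zero.1 ?_).resolve_left (mul_ne_zero h1 h2)
    linear_combination h

lemma IsEquilibrium.comp_perm (h : IsEquilibrium ζ x) (σ : Equiv.Perm (Fin n)) :
    IsEquilibrium ζ (x ∘ σ) := by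
  rw [isEquilibrium_iff_real] at h ⊢
  intro k
  rw [← h (σ k)]
  congr 2
  refine Finset.sum_bij (fun j _ => σ j) ?_ ?_ ?_ ?_
  · intro j hj; simpa using hj
  · intro i _ j _ hij; exact σ.injective hij
  · intro j hj; exact ⟨σ.symm j, by simpa [Equiv.symm_apply_eq] using hj, by simp⟩
  · intro j _; rfl

/-- At equilibrium, the field polynomial agrees to second order at the nodes with the combination
of squares of Lagrange basis polynomials that has the same values there. -/
lemma sq_nodal_dvd_of_isEquilibrium (hx : Function.Injective x) (h : IsEquilibrium ζ x) :
    Lagrange.nodal univ x ^ 2 ∣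
      fieldPoly ζ - ∑ k, C ((fieldPoly ζ).eval (x k)) * basisPoly x k ^ 2 := by
  refine sq_nodal_dvd hx (fun k => ?_) fun k => ?_
  · rw [eval_sub, eval_finsetSum, Finset.sum_eq_single k]
    · simp [eval_basisPoly_self hx]
    · intro j _ hj; simp [eval_basisPoly_of_ne hj]
    · simp
  · rw [derivative_sub, derivative_sum, eval_sub, eval_finsetSum, Finset.sum_eq_single k]
    · have e := (isEquilibrium_iff hx).1 h k
      have h1 := eval_cofactor_self_ne_zero hx k
      have hb : (derivative (basisPoly x k)).eval (x k)
          = ((cofactor x k).eval (x k))⁻¹ * (derivative (cofactor x k)).eval (x k) := by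
        rw [basisPoly_eq x]; simp [derivative_mul]
      simp only [derivative_mul, derivative_C, zero_mul, zero_add, derivative_pow, eval_mul,
        eval_C, eval_pow, Nat.cast_ofNat, eval_basisPoly_self hx, hb]
      norm_num
      field_simp
      linear_combination -e
    · intro j _ hj; simp [derivative_pow, derivative_mul, eval_basisPoly_of_ne hj]
    · simp

lemma natDegree_sum_basisPoly_le (hx : Function.Injective x) (d : Fin n → ℝ) :
    (∑ k, C (d k) * basisPoly x k ^ 2).natDegree ≤ 2 * (n - 1) := by
  refine natDegree_sum_le_of_forall_le _ _ fun k _ => ?_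
  refine (natDegree_C_mul_le _ _).trans ?_
  rw [natDegree_pow, natDegree_basisPoly hx]

/-- The difference of the two sides has degree at most 2m but is divisible by a polynomial of degree
2(m + 1). -/
lemma fieldPoly_eq_sum {x : Fin (m + 1) → ℝ} (hx : Function.Injective x)
    (h : IsEquilibrium ζ x) :
    fieldPoly ζ = ∑ k, C ((fieldPoly ζ).eval (x k)) * basisPoly x k ^ 2 := by
  refine sub_eq_zero.1 (eq_zero_of_dvd_of_natDegree_lt (sq_nodal_dvd_of_isEquilibrium hx h) ?_)
  have h1 : (Lagrange.nodal univ x ^ 2).natDegree = 2 * (m + 1) := by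
    rw [natDegree_pow, Lagrange.natDegree_nodal]; simp
  rw [h1]
  refine lt_of_le_of_lt (natDegree_sub_le _ _) (max_lt ?_ ?_)
  · rw [natDegree_fieldPoly]; omega
  · exact lt_of_le_of_lt (natDegree_sum_basisPoly_le hx _) (by omega)

/-- With one node fewer, the divisor N² has the degree of F. Both are monic, so subtracting N² once
lowers the degree enough for divisibility to force zero. -/
lemma fieldPoly_eq_sq_add_sum {t : Fin m → ℝ} (ht : Function.Injective t)
    (h : IsEquilibrium ζ t) :
    fieldPoly ζ = Lagrange.nodal univ t ^ 2
      + ∑ k, C ((fieldPoly ζ).eval (t k)) * basisPoly t k ^ 2 := by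
  have hM : (Lagrange.nodal univ t ^ 2).Monic := Lagrange.nodal_monic.pow 2
  have h1 : (Lagrange.nodal univ t ^ 2).natDegree = 2 * m := by
    rw [natDegree_pow, Lagrange.natDegree_nodal]; simp
  -- For m = 0 the bound 2 * (m - 1) truncates to 0 and is not below 2 * m, so this case is
  -- separate.
  rcases Nat.eq_zero_or_pos m with rfl | hm
  · simp [fieldPoly, Lagrange.nodal]
  have hd : (fieldPoly ζ - Lagrange.nodal univ t ^ 2).degree
      < (Lagrange.nodal univ t ^ 2).degree := by
    have hdeg : (fieldPoly ζ).degree = (Lagrange.nodal univ t ^ 2).degree := by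
      rw [degree_eq_natDegree (monic_fieldPoly ζ).ne_zero, degree_eq_natDegree hM.ne_zero, h1,
        natDegree_fieldPoly]
    rw [← hdeg]
    exact degree_sub_lt_left hdeg (monic_fieldPoly ζ).ne_zero
      ((monic_fieldPoly ζ).leadingCoeff.trans hM.leadingCoeff.symm)
  have hs : (∑ k, C ((fieldPoly ζ).eval (t k)) * basisPoly t k ^ 2).degree
      < (Lagrange.nodal univ t ^ 2).degree := by
    rw [degree_eq_natDegree hM.ne_zero, h1]
    refine degree_le_natDegree.trans_lt ?_
    exact_mod_cast lt_of_le_of_lt (natDegree_sum_basisPoly_le ht _) (by omega)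
  have hdvd := dvd_sub (sq_nodal_dvd_of_isEquilibrium ht h) (dvd_refl (Lagrange.nodal univ t ^ 2))
  have := eq_zero_of_dvd_of_degree_lt hdvd (by
    rw [sub_right_comm]
    exact (degree_sub_le _ _).trans_lt (max_lt hd hs))
  linear_combination this

end Equilibrium

/-! ### Uniqueness of equilibria. -/

section Uniqueness

/-- Expand the nonnegative sum Σ (d_k A_kj - e_j B_jk)² / (d_k e_j). The cross terms are constant
because of `hAB`, and the rest is a sum of nonpositive defects in `hA` and `hB`, so everything
vanishes. -/
lemma weighted_inverse_eq_transpose {ι κ : Type*} [Fintype ι] [Fintype κ]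
    (hcard : Fintype.card ι = Fintype.card κ)
    {A : ι → κ → ℝ} {B : κ → ι → ℝ} {d : ι → ℝ} {e : κ → ℝ} (hd : ∀ k, 0 < d k)
    (he : ∀ j, 0 < e j) (hAB : ∀ k, ∑ j, A k j * B j k = 1)
    (hA : ∀ j, ∑ k, d k * A k j ^ 2 ≤ e j) (hB : ∀ k, ∑ j, e j * B j k ^ 2 ≤ d k) :
    (∀ k j, d k * A k j = e j * B j k) ∧ ∀ j, ∑ k, d k * A k j ^ 2 = e j := by
  have expand : ∑ k, ∑ j, (d k * A k j - e j * B j k) ^ 2 / (d k * e j)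
      = ∑ j, ((∑ k, d k * A k j ^ 2) / e j - 1) + ∑ k, ((∑ j, e j * B j k ^ 2) / d k - 1) := by
    have h1 : ∀ k j, (d k * A k j - e j * B j k) ^ 2 / (d k * e j)
        = d k * A k j ^ 2 / e j + e j * B j k ^ 2 / d k - 2 * (A k j * B j k) := by
      intro k j
      have := (hd k).ne'
      have := (he j).ne'
      field_simp
      ring
    simp_rw [h1, Finset.sum_sub_distrib, Finset.sum_add_distrib, ← Finset.mul_sum, hAB,
      Finset.sum_div]
    -- The cross terms give -2 for each `k`; `hcard` lets them be split as -1 for each `k` and -1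
    -- for each `j`.
    rw [Finset.sum_comm]
    simp only [sum_const, card_univ, hcard]
    simp
    ring
  have n1 : ∀ j, (∑ k, d k * A k j ^ 2) / e j - 1 ≤ 0 := fun j => by
    rw [sub_nonpos, div_le_one (he j)]; exact hA j
  have n2 : ∀ k, (∑ j, e j * B j k ^ 2) / d k - 1 ≤ 0 := fun k => by
    rw [sub_nonpos, div_le_one (hd k)]; exact hB k
  have p : ∀ k j, 0 ≤ (d k * A k j - e j * B j k) ^ 2 / (d k * e j) := fun k j =>
    div_nonneg (sq_nonneg _) (mul_pos (hd k) (he j)).le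
  have hsum : 0 ≤ ∑ k, ∑ j, (d k * A k j - e j * B j k) ^ 2 / (d k * e j) :=
    Finset.sum_nonneg fun k _ => Finset.sum_nonneg fun j _ => p k j
  have s1 : ∑ j, ((∑ k, d k * A k j ^ 2) / e j - 1) ≤ 0 := Finset.sum_nonpos fun j _ => n1 j
  have s2 : ∑ k, ((∑ j, e j * B j k ^ 2) / d k - 1) ≤ 0 := Finset.sum_nonpos fun k _ => n2 k
  constructor
  · intro k j
    have z := (Finset.sum_eq_zero_iff_of_nonneg fun k _ =>
      Finset.sum_nonneg fun j _ => p k j).1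
        (le_antisymm (expand.trans_le (add_nonpos s1 s2)) hsum) k (mem_univ k)
    have z' := (Finset.sum_eq_zero_iff_of_nonneg fun j _ => p k j).1 z j (mem_univ j)
    have := (mul_pos (hd k) (he j)).ne'
    have := pow_eq_zero_iff (two_ne_zero) |>.1 ((div_eq_zero_iff.1 z').resolve_right this)
    linarith
  · intro j
    have z := (Finset.sum_eq_zero_iff_of_nonpos fun j _ => n1 j).1
      (le_antisymm s1 ((expand ▸ hsum).trans (add_le_of_nonpos_right s2))) j (mem_univ j)
    rwa [sub_eq_zero, div_eq_one_iff_eq (he j).ne'] at z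

variable {m : ℕ} {ζ : Fin m → UpperHalfPlane}

lemma sum_basisPoly_mul_basisPoly {n : ℕ} {x y : Fin n → ℝ} (hx : Function.Injective x)
    (hy : Function.Injective y) (k : Fin n) :
    ∑ j, (basisPoly x k).eval (y j) * (basisPoly y j).eval (x k) = 1 := by
  rw [sum_eval_mul_eval_basisPoly hy (degree_basisPoly_lt hx k), eval_basisPoly_self hx]

lemma root_of_eval_nodal_eq_zero {n : ℕ} {x : Fin n → ℝ} {u : ℝ}
    (h : (Lagrange.nodal univ x).eval u = 0) : ∃ k, x k = u := by
  rw [Lagrange.eval_nodal, Finset.prod_eq_zero_iff] at h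
  obtain ⟨k, _, hk⟩ := h
  exact ⟨k, (sub_eq_zero.1 hk).symm⟩

theorem IsEquilibrium.exists_eq {t t' : Fin m → ℝ} (ht : Function.Injective t)
    (h : IsEquilibrium ζ t) (ht' : Function.Injective t') (h' : IsEquilibrium ζ t') (j : Fin m) :
    ∃ k, t k = t' j := by
  have hval : ∀ {t : Fin m → ℝ} (_ : Function.Injective t) (_ : IsEquilibrium ζ t) (u : ℝ),
      (fieldPoly ζ).eval u = (Lagrange.nodal univ t).eval u ^ 2
        + ∑ k, (fieldPoly ζ).eval (t k) * (basisPoly t k).eval u ^ 2 := by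
    intro t ht h u
    conv_lhs => rw [fieldPoly_eq_sq_add_sum ht h]
    simp [eval_finsetSum]
  have := (weighted_inverse_eq_transpose rfl (fun k => eval_fieldPoly_pos ζ (t k))
    (fun j => eval_fieldPoly_pos ζ (t' j)) (sum_basisPoly_mul_basisPoly ht ht')
    (fun j => by rw [hval ht h (t' j)]; exact le_add_of_nonneg_left (sq_nonneg _))
    (fun k => by rw [hval ht' h' (t k)]; exact le_add_of_nonneg_left (sq_nonneg _))).2 j
  -- The bound was obtained by dropping N(t'_j)², so equality in it says that N vanishes at t'_j.
  rw [hval ht h (t' j)] at this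
  refine root_of_eval_nodal_eq_zero (pow_eq_zero_iff (two_ne_zero) |>.1 ?_)
  linarith

theorem IsEquilibrium.exists_eq_of_common {x y : Fin (m + 1) → ℝ} (hx : Function.Injective x)
    (h : IsEquilibrium ζ x) (hy : Function.Injective y) (h' : IsEquilibrium ζ y)
    {k₀ : Fin (m + 1)} (h₀ : x k₀ = y k₀) (k : Fin (m + 1)) : ∃ j, y j = x k := by
  have hval : ∀ {x : Fin (m + 1) → ℝ} (_ : Function.Injective x) (_ : IsEquilibrium ζ x) (u : ℝ),
      ∑ k, (fieldPoly ζ).eval (x k) * (basisPoly x k).eval u ^ 2 = (fieldPoly ζ).eval u := by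
    intro x hx h u
    conv_rhs => rw [fieldPoly_eq_sum hx h]
    simp [eval_finsetSum]
  rcases eq_or_ne k k₀ with rfl | hk
  · exact ⟨k, h₀.symm⟩
  have := (weighted_inverse_eq_transpose rfl (fun k => eval_fieldPoly_pos ζ (x k))
    (fun j => eval_fieldPoly_pos ζ (y j)) (sum_basisPoly_mul_basisPoly hx hy)
    (fun j => (hval hx h (y j)).le) (fun k => (hval hy h' (x k)).le)).1 k k₀
  -- At the common node the basis polynomial of x with index `k` vanishes, so the transpose relation
  -- makes the basis polynomial of y with index `k₀` vanish at `x k`.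
  rw [← h₀, eval_basisPoly_of_ne hk, mul_zero, eq_comm, mul_eq_zero] at this
  have h1 := this.resolve_left (eval_fieldPoly_pos ζ _).ne'
  refine root_of_eval_nodal_eq_zero ?_
  rw [basisPoly_eq y, eval_mul, eval_C, mul_eq_zero] at h1
  rw [nodal_eq_mul_cofactor y k₀, eval_mul,
    h1.resolve_left (inv_ne_zero (eval_cofactor_self_ne_zero hy k₀)), mul_zero]

end Uniqueness

/-! ### The energy: symmetry, gradient, critical points. -/

section Energy

variable {m : ℕ} (ζ : Fin m → UpperHalfPlane)

lemma sum_erase_eq_two_mul_sum_Ioi (f : Fin m → Fin m → ℝ) (hf : ∀ i j, f i j = f j i) :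
    ∑ k, ∑ j ∈ univ.erase k, f k j = 2 * ∑ k, ∑ j ∈ Ioi k, f k j := by
  have h1 : ∀ k : Fin m, ∑ j ∈ univ.erase k, f k j
      = ∑ j ∈ Ioi k, f k j + ∑ j ∈ Iio k, f k j := by
    intro k
    rw [← Finset.sum_union]
    · refine Finset.sum_congr ?_ fun _ _ => rfl
      ext j
      simp only [mem_erase, mem_univ, and_true, mem_union, mem_Ioi, mem_Iio]
      exact ne_comm.trans lt_or_lt_iff_ne.symm
    · exact Finset.disjoint_left.2 fun j h1 h2 => lt_asymm (mem_Ioi.1 h1) (mem_Iio.1 h2)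
  have h2 : ∑ k, ∑ j ∈ Iio k, f k j = ∑ k, ∑ j ∈ Ioi k, f k j := by
    rw [Finset.sum_comm' (t' := univ) (s' := fun j => Ioi j) (by simp)]
    exact Finset.sum_congr rfl fun k _ => Finset.sum_congr rfl fun j _ => hf _ _
  rw [Finset.sum_congr rfl fun k _ => h1 k, Finset.sum_add_distrib, h2, two_mul]

lemma sum_erase_comm (f : Fin m → Fin m → ℝ) :
    ∑ k, ∑ j ∈ univ.erase k, f k j = ∑ k, ∑ j ∈ univ.erase k, f j k :=
  Finset.sum_comm' (by simp [ne_comm])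

lemma norm_mul_conj_sub (z : UpperHalfPlane) (u : ℝ) :
    ‖((u : ℂ) - (z : ℂ)) * ((u : ℂ) - (starRingEnd ℂ) (z : ℂ))‖ = (u - z.re) ^ 2 + z.im ^ 2 := by
  have hc : (u : ℂ) - (starRingEnd ℂ) (z : ℂ) = (starRingEnd ℂ) ((u : ℂ) - (z : ℂ)) := by simp
  rw [hc, Complex.mul_conj, Complex.norm_real, Complex.normSq_apply]
  rw [Real.norm_of_nonneg (add_nonneg (mul_self_nonneg _) (mul_self_nonneg _))]
  simp
  ring

/-- `Real.log` is even, which absorbs the absolute values, and summing over ordered pairs absorbs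
the factor 2. Since `Real.log 0 = 0` on both sides, distinctness of the points is not needed. -/
lemma energy_eq (t : Fin m → ℝ) : energy ζ t
    = ∑ k, Real.log ((fieldPoly ζ).eval (t k))
      - ∑ k, ∑ j ∈ univ.erase k, Real.log (t j - t k) := by
  rw [energy]
  simp_rw [norm_mul_conj_sub, Real.log_abs]
  rw [sum_erase_eq_two_mul_sum_Ioi (fun k j => Real.log (t j - t k))
    (fun i j => by rw [← Real.log_neg_eq_log, neg_sub])]
  congr 1
  refine Finset.sum_congr rfl fun k _ => ?_
  rw [eval_fieldPoly, Real.log_prod fun j _ => (quadratic_pos _ _).ne']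

lemma energy_comp_perm (t : Fin m → ℝ) (σ : Equiv.Perm (Fin m)) :
    energy ζ (t ∘ σ) = energy ζ t := by
  rw [energy_eq, energy_eq]
  congr 1
  · exact Equiv.sum_comp σ fun k => Real.log ((fieldPoly ζ).eval (t k))
  · rw [← Equiv.sum_comp σ fun k => ∑ j ∈ univ.erase k, Real.log (t j - t k)]
    refine Finset.sum_congr rfl fun k _ => ?_
    refine Finset.sum_bij (fun j _ => σ j) ?_ ?_ ?_ ?_
    · intro j hj; simpa using hj
    · intro i _ j _ hij; exact σ.injective hij
    · intro j hj; exact ⟨σ.symm j, by simpa [Equiv.symm_apply_eq] using hj, by simp⟩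
    · intro j _; rfl

/-- The gradient of the energy. -/
noncomputable def gradient (t : Fin m → ℝ) (k : Fin m) : ℝ :=
  ∑ j, 2 * (t k - (ζ j).re) / ((t k - (ζ j).re) ^ 2 + (ζ j).im ^ 2)
    - 2 * ∑ j ∈ univ.erase k, 1 / (t k - t j)

lemma isEquilibrium_iff_gradient (t : Fin m → ℝ) :
    IsEquilibrium ζ t ↔ ∀ k, gradient ζ t k = 0 := by
  rw [isEquilibrium_iff_real]
  refine forall_congr' fun k => ?_
  rw [gradient, sub_eq_zero, sub_eq_zero, eq_comm]

lemma hasFDerivAt_energy {t : Fin m → ℝ} (ht : Function.Injective t) :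
    HasFDerivAt (energy ζ)
      (∑ k, gradient ζ t k • (ContinuousLinearMap.proj k : (Fin m → ℝ) →L[ℝ] ℝ)) t := by
  have he : energy ζ = fun t => ∑ k, Real.log ((fieldPoly ζ).eval (t k))
      - ∑ k, ∑ j ∈ univ.erase k, Real.log (t j - t k) := funext (energy_eq ζ)
  have hp : ∀ k, HasFDerivAt (fun s : Fin m → ℝ => s k)
      (ContinuousLinearMap.proj k : (Fin m → ℝ) →L[ℝ] ℝ) t := fun k => hasFDerivAt_apply k t
  have h1 : ∀ k, HasFDerivAt (fun s : Fin m → ℝ => Real.log ((fieldPoly ζ).eval (s k)))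
      (((fieldPoly ζ).eval (t k))⁻¹ • (derivative (fieldPoly ζ)).eval (t k) •
        (ContinuousLinearMap.proj k : (Fin m → ℝ) →L[ℝ] ℝ)) t := fun k =>
    HasFDerivAt.log (HasDerivAt.comp_hasFDerivAt (h₂ := fun u => (fieldPoly ζ).eval u) t
      ((fieldPoly ζ).hasDerivAt (t k)) (hp k)) (eval_fieldPoly_pos ζ (t k)).ne'
  have h2 : ∀ k, ∀ j ∈ univ.erase k, HasFDerivAt (fun s : Fin m → ℝ => Real.log (s j - s k))
      ((t j - t k)⁻¹ • ((ContinuousLinearMap.proj j : (Fin m → ℝ) →L[ℝ] ℝ)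
        - ContinuousLinearMap.proj k)) t := fun k j hj =>
    ((hp j).sub (hp k)).log (sub_ne_zero.2 (ht.ne (Finset.ne_of_mem_erase hj)))
  rw [he]
  refine ((HasFDerivAt.fun_sum fun k _ => h1 k).sub
    (HasFDerivAt.fun_sum fun k _ => HasFDerivAt.fun_sum (h2 k))).congr_fderiv ?_
  ext v
  simp only [_root_.sub_apply, _root_.sum_apply,
    _root_.smul_apply, ContinuousLinearMap.proj_apply, smul_eq_mul, gradient]
  -- Exchanging the roles of the indices collects the coefficient of `v k`; each pair contributes to
  -- it twice.
  have h3 : ∑ k, ∑ j ∈ univ.erase k, (t j - t k)⁻¹ * (v j - v k)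
      = ∑ k, (2 * ∑ j ∈ univ.erase k, 1 / (t k - t j)) * v k := by
    simp_rw [mul_sub, Finset.sum_sub_distrib]
    rw [sum_erase_comm fun k j => (t j - t k)⁻¹ * v j, ← Finset.sum_sub_distrib]
    refine Finset.sum_congr rfl fun k _ => ?_
    rw [← Finset.sum_sub_distrib, Finset.mul_sum, Finset.sum_mul]
    refine Finset.sum_congr rfl fun j _ => ?_
    rw [← neg_sub (t k) (t j), inv_neg]
    ring
  rw [h3, ← Finset.sum_sub_distrib]
  refine Finset.sum_congr rfl fun k _ => ?_
  rw [eval_derivative_fieldPoly, sub_mul, ← mul_assoc,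
    inv_mul_cancel_left₀ (eval_fieldPoly_pos ζ (t k)).ne']

lemma isCriticalPoint_iff (s : Fin m → ℝ) :
    IsCriticalPoint ζ s ↔ Function.Injective s ∧ IsEquilibrium ζ s := by
  rw [IsCriticalPoint, configurations, Set.mem_ofPred_eq]
  refine and_congr_right fun hs => ?_
  have h := hasFDerivAt_energy ζ hs
  rw [isEquilibrium_iff_gradient]
  constructor
  · intro h0 k
    have := DFunLike.congr_fun (h.unique h0) (Pi.single k 1)
    simpa [_root_.sum_apply, Pi.single_apply] using this
  · intro h0
    simpa [h0] using h

lemma isOpen_configurations : IsOpen (configurations m) := by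
  have : configurations m = ⋂ i : Fin m, ⋂ j : Fin m, {t | i ≠ j → t i ≠ t j} := by
    ext t
    simp only [configurations, Set.mem_ofPred_eq, Set.mem_iInter]
    exact ⟨fun h i j hij => h.ne hij, fun h i j hij => by_contra fun hne => h i j hne hij⟩
  rw [this]
  refine isOpen_iInter_of_finite fun i => isOpen_iInter_of_finite fun j => ?_
  by_cases hij : i = j
  · simp [hij]
  · simpa [hij] using isOpen_ne_fun (continuous_apply i) (continuous_apply j)

lemma isEquilibrium_of_isMinOn {s : Fin m → ℝ} (hs : s ∈ configurations m)
    (h : IsMinOn (energy ζ) (configurations m) s) : IsEquilibrium ζ s := by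
  have hloc : IsLocalMin (energy ζ) s := h.isLocalMin (isOpen_configurations.mem_nhds hs)
  have hd := hasFDerivAt_energy ζ hs
  have h0 := hloc.hasFDerivAt_eq_zero hd
  rw [h0] at hd
  exact ((isCriticalPoint_iff ζ s).1 ⟨hs, hd⟩).2

/-! ### Existence of a minimiser by decay of exp(-W). -/

/-- The exponential of minus the energy, extended by zero to all tuples. -/
noncomputable def gibbs (t : Fin m → ℝ) : ℝ :=
  (∏ k, ∏ j ∈ univ.erase k, |t j - t k|) / ∏ k, (fieldPoly ζ).eval (t k)

lemma prod_fieldPoly_pos (t : Fin m → ℝ) : 0 < ∏ k, (fieldPoly ζ).eval (t k) :=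
  Finset.prod_pos fun _ _ => eval_fieldPoly_pos ζ _

lemma gibbs_pos_iff (t : Fin m → ℝ) : 0 < gibbs ζ t ↔ Function.Injective t := by
  rw [gibbs, div_pos_iff_of_pos_right (prod_fieldPoly_pos ζ t)]
  constructor
  · intro h i j hij
    by_contra hne
    have h1 := Finset.prod_ne_zero_iff.1 h.ne' i (mem_univ i)
    have h2 := Finset.prod_ne_zero_iff.1 h1 j (by simp [Ne.symm hne])
    simp [hij] at h2
  · intro h
    exact Finset.prod_pos fun k _ => Finset.prod_pos fun j hj =>
      abs_pos.2 (sub_ne_zero.2 (h.ne (Finset.ne_of_mem_erase hj)))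

lemma log_gibbs {t : Fin m → ℝ} (ht : Function.Injective t) :
    Real.log (gibbs ζ t) = -energy ζ t := by
  have h0 : ∀ k, ∀ j ∈ univ.erase k, |t j - t k| ≠ 0 := fun k j hj =>
    abs_ne_zero.2 (sub_ne_zero.2 (ht.ne (Finset.ne_of_mem_erase hj)))
  rw [gibbs, Real.log_div (Finset.prod_ne_zero_iff.2 fun k _ => Finset.prod_ne_zero_iff.2 (h0 k))
    (prod_fieldPoly_pos ζ t).ne', Real.log_prod fun k _ => Finset.prod_ne_zero_iff.2 (h0 k),
    Real.log_prod fun k _ => (eval_fieldPoly_pos ζ _).ne', energy_eq, neg_sub]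
  congr 1
  refine Finset.sum_congr rfl fun k _ => ?_
  rw [Real.log_prod (h0 k)]
  simp

lemma continuous_gibbs : Continuous (gibbs ζ) := by
  refine Continuous.div ?_ ?_ fun t => (prod_fieldPoly_pos ζ t).ne'
  · fun_prop
  · exact continuous_finsetProd _ fun k _ =>
      (fieldPoly ζ).continuous.comp (continuous_apply k)

lemma exists_mul_pow_le_fieldPoly :
    ∃ c > 0, ∀ u : ℝ, c * (1 + u ^ 2) ^ m ≤ (fieldPoly ζ).eval u := by
  have h : ∀ j, ∃ c > 0, ∀ u : ℝ, c * (1 + u ^ 2) ≤ (u - (ζ j).re) ^ 2 + (ζ j).im ^ 2 := by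
    intro j
    have hb := (ζ j).im_pos
    have hb2 : 0 < (ζ j).im ^ 2 := by positivity
    set a := (ζ j).re
    set b := (ζ j).im
    -- The constant comes from 1 + u² ≤ 2(u - a)² + (1 + 2a²), whose two terms are bounded by
    -- multiples 2 and (1 + 2a²)/b² of (u - a)² + b².
    refine ⟨(2 + (1 + 2 * a ^ 2) / b ^ 2)⁻¹, by positivity, fun u => ?_⟩
    rw [inv_mul_le_iff₀ (by positivity)]
    have h1 : (2 + (1 + 2 * a ^ 2) / b ^ 2) * ((u - a) ^ 2 + b ^ 2)
        = 2 * (u - a) ^ 2 + 2 * b ^ 2 + (1 + 2 * a ^ 2) / b ^ 2 * (u - a) ^ 2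
          + (1 + 2 * a ^ 2) := by
      field_simp
      ring
    have h2 : 0 ≤ (1 + 2 * a ^ 2) / b ^ 2 * (u - a) ^ 2 := by positivity
    nlinarith [sq_nonneg (u - 2 * a)]
  choose c hc h using h
  refine ⟨∏ j, c j, Finset.prod_pos fun j _ => hc j, fun u => ?_⟩
  have hm : (1 + u ^ 2) ^ m = ∏ _j : Fin m, (1 + u ^ 2) := by simp
  rw [eval_fieldPoly, hm, ← Finset.prod_mul_distrib]
  exact Finset.prod_le_prod (fun j _ => mul_nonneg (hc j).le (by positivity)) fun j _ => h j u

/-- Since (1 + a²)(1 + b²) - (a - b)² = (1 + ab)², each distance is at most √(1 + a²) √(1 + b²), and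
each point occurs in 2(m - 1) ordered pairs. -/
lemma prod_abs_sub_le (t : Fin m → ℝ) :
    ∏ k, ∏ j ∈ univ.erase k, |t j - t k| ≤ ∏ k, (1 + t k ^ 2) ^ (m - 1) := by
  have h1 : ∀ a b : ℝ, |a - b| ≤ √(1 + a ^ 2) * √(1 + b ^ 2) := by
    intro a b
    rw [← Real.sqrt_mul (by positivity)]
    refine Real.le_sqrt_of_sq_le ?_
    rw [sq_abs]
    nlinarith [sq_nonneg (1 + a * b)]
  have h2 : ∏ k, ∏ j ∈ univ.erase k, (√(1 + t j ^ 2) * √(1 + t k ^ 2))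
      = ∏ k, (1 + t k ^ 2) ^ (m - 1) := by
    simp_rw [Finset.prod_mul_distrib]
    rw [Finset.prod_comm' (t' := univ) (s' := fun j => univ.erase j) (by simp [ne_comm]),
      ← Finset.prod_mul_distrib]
    refine Finset.prod_congr rfl fun k _ => ?_
    rw [Finset.prod_const, ← mul_pow, Real.mul_self_sqrt (by positivity)]
    simp
  rw [← h2]
  exact Finset.prod_le_prod (fun k _ => Finset.prod_nonneg fun j _ => abs_nonneg _) fun k _ =>
    Finset.prod_le_prod (fun j _ => abs_nonneg _) fun j _ => h1 _ _

lemma norm_le_prod (t : Fin m → ℝ) : ‖t‖ ≤ ∏ k, (1 + t k ^ 2) := by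
  refine (pi_norm_le_iff_of_nonneg (Finset.prod_nonneg fun k _ => by positivity)).2 fun i => ?_
  have h1 : ‖t i‖ ≤ 1 + t i ^ 2 := by
    rw [Real.norm_eq_abs, ← sq_abs]
    nlinarith [sq_nonneg (|t i| - 1)]
  rw [← Finset.mul_prod_erase univ _ (mem_univ i)]
  refine h1.trans (le_mul_of_one_le_right (by positivity) ?_)
  exact Finset.prod_const_one.symm.trans_le (Finset.prod_le_prod (fun _ _ => zero_le_one)
    fun k _ => le_add_of_nonneg_right (sq_nonneg (t k)))

/-- The numerator grows like ∏ (1 + t_k²)^(m-1), the denominator at least like ∏ (1 + t_k²)^m. The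
spare factor dominates the norm, which gives decay at infinity. -/
lemma exists_gibbs_mul_norm_le : ∃ K > 0, ∀ t, gibbs ζ t * ‖t‖ ≤ K := by
  obtain ⟨c, hc, h⟩ := exists_mul_pow_le_fieldPoly ζ
  refine ⟨(c ^ m)⁻¹, by positivity, fun t => ?_⟩
  rw [gibbs, div_mul_eq_mul_div, div_le_iff₀ (prod_fieldPoly_pos ζ t)]
  have h1 : (c ^ m)⁻¹ * ∏ k, (c * (1 + t k ^ 2) ^ m) ≤
      (c ^ m)⁻¹ * ∏ k, (fieldPoly ζ).eval (t k) :=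
    mul_le_mul_of_nonneg_left
      (Finset.prod_le_prod (fun k _ => by positivity) fun k _ => h (t k)) (by positivity)
  refine le_trans ?_ h1
  rw [Finset.prod_mul_distrib, Finset.prod_const, card_univ, Fintype.card_fin,
    inv_mul_cancel_left₀ (pow_pos hc m).ne']
  refine (mul_le_mul (prod_abs_sub_le t) (norm_le_prod t) (norm_nonneg _)
    (Finset.prod_nonneg fun k _ => by positivity)).trans_eq ?_
  rw [← Finset.prod_mul_distrib]
  refine Finset.prod_congr rfl fun k _ => ?_
  rw [← pow_succ, Nat.sub_add_cancel (Fin.pos k)]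

lemma exists_isMinOn_energy :
    ∃ t ∈ configurations m, IsMinOn (energy ζ) (configurations m) t := by
  obtain ⟨K, hK, hb⟩ := exists_gibbs_mul_norm_le ζ
  -- Any configuration of distinct points will do: it supplies a positive value that is not exceeded
  -- outside a compact set.
  set s₀ : Fin m → ℝ := fun i => (i : ℕ) with hs₀
  have hi : Function.Injective s₀ := fun i j h => by
    simp only [hs₀, Nat.cast_inj] at h
    exact Fin.ext h
  have hp := (gibbs_pos_iff ζ s₀).2 hi
  obtain ⟨t, ht⟩ := (continuous_gibbs ζ).exists_forall_ge' s₀ (by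
    filter_upwards [(tendsto_norm_cocompact_atTop (E := Fin m → ℝ)).eventually_ge_atTop
      (K / gibbs ζ s₀)] with t ht
    have h1 : 0 < ‖t‖ := (div_pos hK hp).trans_le ht
    rw [div_le_iff₀ hp] at ht
    have := (hb t).trans ht
    rw [mul_comm] at this
    exact le_of_mul_le_mul_left this h1)
  have htp : Function.Injective t := (gibbs_pos_iff ζ t).1 (hp.trans_le (ht s₀))
  refine ⟨t, htp, fun s hs => ?_⟩
  have := Real.log_le_log ((gibbs_pos_iff ζ s).2 hs) (ht s)
  rw [log_gibbs ζ hs, log_gibbs ζ htp] at this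
  exact neg_le_neg_iff.1 this

lemma exists_strictMono_comp_perm {s : Fin m → ℝ} (hs : Function.Injective s) :
    ∃ σ : Equiv.Perm (Fin m), StrictMono (s ∘ σ) :=
  ⟨Tuple.sort s, (Tuple.monotone_sort s).strictMono_of_injective
    (hs.comp (Tuple.sort s).injective)⟩

variable {ζ}

theorem IsEquilibrium.eq_of_strictMono {t t' : Fin m → ℝ} (ht : StrictMono t)
    (h : IsEquilibrium ζ t) (ht' : StrictMono t') (h' : IsEquilibrium ζ t') : t' = t := by
  refine (ht'.range_inj ht).1 (Set.Subset.antisymm ?_ ?_)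
  · rintro _ ⟨j, rfl⟩
    exact h.exists_eq ht.injective ht'.injective h' j
  · rintro _ ⟨j, rfl⟩
    exact h'.exists_eq ht'.injective ht.injective h j

theorem IsEquilibrium.exists_perm {s t : Fin m → ℝ} (ht : StrictMono t)
    (h : IsEquilibrium ζ t) (hs : Function.Injective s) (h' : IsEquilibrium ζ s) :
    ∃ σ : Equiv.Perm (Fin m), s = t ∘ σ := by
  obtain ⟨σ, hσ⟩ := exists_strictMono_comp_perm hs
  refine ⟨σ⁻¹, ?_⟩
  rw [← h.eq_of_strictMono ht hσ (h'.comp_perm σ)]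
  ext i
  simp

end Energy

/-! ### The gaps between consecutive nodes and their end filters. -/

section Gaps

variable {m : ℕ} {t : Fin m → ℝ}

@[simp] lemma nodes_zero : nodes t 0 = ⊥ := rfl

@[simp] lemma nodes_last : nodes t (Fin.last (m + 1)) = ⊤ := by
  rw [nodes, ← Fin.succ_last, Fin.cons_succ, Fin.snoc_last]

@[simp] lemma nodes_castSucc_succ (i : Fin m) : nodes t i.castSucc.succ = t i := by
  rw [nodes, Fin.cons_succ, Fin.snoc_castSucc]

@[simp] lemma nodes_succ_castSucc (i : Fin m) : nodes t i.succ.castSucc = t i := by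
  rw [← Fin.succ_castSucc, nodes_castSucc_succ]

lemma strictMono_nodes (ht : StrictMono t) : StrictMono (nodes t) := by
  refine Fin.strictMono_iff_lt_succ.2 fun k => ?_
  have hr : nodes t k.succ = ⊤ ∨ ∃ b : Fin m, k = b.castSucc ∧ nodes t k.succ = t b := by
    induction k using Fin.lastCases with
    | last => left; rw [Fin.succ_last, nodes_last]
    | cast b => right; exact ⟨b, rfl, nodes_castSucc_succ b⟩
  have hl : nodes t k.castSucc = ⊥ ∨ ∃ a : Fin m, k = a.succ ∧ nodes t k.castSucc = t a := by
    induction k using Fin.cases with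
    | zero => left; rw [Fin.castSucc_zero, nodes_zero]
    | succ a => right; exact ⟨a, rfl, nodes_succ_castSucc a⟩
  rcases hr with hr | ⟨b, hb, hr⟩ <;> rcases hl with hl | ⟨a, ha, hl⟩ <;> rw [hl, hr]
  · exact bot_lt_top
  · exact EReal.coe_lt_top _
  · exact EReal.bot_lt_coe _
  · refine EReal.coe_lt_coe_iff.2 (ht ?_)
    rw [← Fin.succ_le_castSucc_iff, ← ha, ← hb]

lemma lt_of_mem_gap (ht : StrictMono t) {j k : Fin (m + 1)} (h : j < k) {u v : ℝ}
    (hu : u ∈ gap t j) (hv : v ∈ gap t k) : u < v := by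
  refine EReal.coe_lt_coe_iff.1 (hu.2.trans_le (le_trans ?_ hv.1.le))
  exact (strictMono_nodes ht).monotone (Fin.succ_le_castSucc_iff.2 h)

lemma eq_of_mem_gap (ht : StrictMono t) {j k : Fin (m + 1)} {u : ℝ}
    (hu : u ∈ gap t j) (hv : u ∈ gap t k) : j = k := by
  rcases lt_trichotomy j k with h | h | h
  · exact absurd (lt_of_mem_gap ht h hu hv) (lt_irrefl _)
  · exact h
  · exact absurd (lt_of_mem_gap ht h hv hu) (lt_irrefl _)

lemma injective_of_mem_gap (ht : StrictMono t) {x : Fin (m + 1) → ℝ} (hx : ∀ k, x k ∈ gap t k) :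
    Function.Injective x := fun j k h => eq_of_mem_gap ht (hx j) (h ▸ hx k)

lemma gap_subset_Ioi_or_Iio (ht : StrictMono t) (k : Fin (m + 1)) (i : Fin m) :
    (∀ u ∈ gap t k, t i < u) ∨ ∀ u ∈ gap t k, u < t i := by
  rcases lt_or_ge i.castSucc k with h | h
  · left
    intro u hu
    refine EReal.coe_lt_coe_iff.1 (lt_of_le_of_lt ?_ hu.1)
    rw [← nodes_castSucc_succ]
    exact (strictMono_nodes ht).monotone (Fin.succ_le_castSucc_iff.2 h)
  · right
    intro u hu
    refine EReal.coe_lt_coe_iff.1 (hu.2.trans_le ?_)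
    rw [← nodes_castSucc_succ]
    exact (strictMono_nodes ht).monotone (Fin.succ_le_succ_iff.2 h)

lemma ne_of_mem_gap (ht : StrictMono t) {k : Fin (m + 1)} {u : ℝ} (hu : u ∈ gap t k) (i : Fin m) :
    u - t i ≠ 0 := by
  rw [sub_ne_zero]
  rcases gap_subset_Ioi_or_Iio ht k i with h | h
  · exact (h u hu).ne'
  · exact (h u hu).ne

lemma ordConnected_gap (k : Fin (m + 1)) : (gap t k).OrdConnected :=
  ⟨fun _ hu _ hv _ hw => ⟨hu.1.trans_le (EReal.coe_le_coe_iff.2 hw.1),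
    (EReal.coe_le_coe_iff.2 hw.2).trans_lt hv.2⟩⟩

lemma exists_mem_gap_lt (ht : StrictMono t) (k : Fin (m + 1)) {a : EReal}
    (ha : nodes t k.castSucc < a) : ∃ y ∈ gap t k, (y : EReal) < a := by
  obtain ⟨y, h1, h2⟩ := EReal.lt_iff_exists_real_btwn.1
    (lt_min ha (strictMono_nodes ht (Fin.castSucc_lt_succ (i := k))))
  exact ⟨y, ⟨h1, h2.trans_le (min_le_right _ _)⟩, h2.trans_le (min_le_left _ _)⟩

lemma exists_mem_gap_gt (ht : StrictMono t) (k : Fin (m + 1)) {a : EReal}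
    (ha : a < nodes t k.succ) : ∃ y ∈ gap t k, a < (y : EReal) := by
  obtain ⟨y, h1, h2⟩ := EReal.lt_iff_exists_real_btwn.1
    (max_lt ha (strictMono_nodes ht (Fin.castSucc_lt_succ (i := k))))
  exact ⟨y, ⟨(le_max_right _ _).trans_lt h1, h2⟩, (le_max_left _ _).trans_lt h1⟩

lemma neBot_toLeftEnd (ht : StrictMono t) (k : Fin (m + 1)) : (toLeftEnd t k).NeBot := by
  rw [toLeftEnd, inf_principal_neBot_iff]
  rintro U ⟨V, hV, hVU⟩
  obtain ⟨a, ha, hs⟩ := exists_Ico_subset_of_mem_nhds hV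
    ⟨_, strictMono_nodes ht (Fin.castSucc_lt_succ (i := k))⟩
  obtain ⟨y, hy, hya⟩ := exists_mem_gap_lt ht k ha
  exact ⟨y, hVU (hs ⟨hy.1.le, hya⟩), hy⟩

lemma neBot_toRightEnd (ht : StrictMono t) (k : Fin (m + 1)) : (toRightEnd t k).NeBot := by
  rw [toRightEnd, inf_principal_neBot_iff]
  rintro U ⟨V, hV, hVU⟩
  obtain ⟨a, ha, hs⟩ := exists_Ioc_subset_of_mem_nhds hV
    ⟨_, strictMono_nodes ht (Fin.castSucc_lt_succ (i := k))⟩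
  obtain ⟨y, hy, hya⟩ := exists_mem_gap_gt ht k ha
  exact ⟨y, hVU (hs ⟨hya, hy.2.le⟩), hy⟩

lemma tendsto_toLeftEnd (k : Fin (m + 1)) :
    Tendsto (fun u : ℝ => (u : EReal)) (toLeftEnd t k) (𝓝 (nodes t k.castSucc)) :=
  tendsto_comap.mono_left inf_le_left

lemma tendsto_toRightEnd (k : Fin (m + 1)) :
    Tendsto (fun u : ℝ => (u : EReal)) (toRightEnd t k) (𝓝 (nodes t k.succ)) :=
  tendsto_comap.mono_left inf_le_left

end Gaps

/-! ### The Pick function and its inverse branches. -/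

section Pick

variable {m : ℕ} {t a : Fin m → ℝ}

/-- The rational function `u - ∑ a k / (u - t k)`. -/
noncomputable def pickFun (t a : Fin m → ℝ) (u : ℝ) : ℝ := u - ∑ k, a k / (u - t k)

/-- Each pole lies on one side of the gap, so no term -a/(u - t) decreases there, while u itself
increases strictly. -/
lemma strictMonoOn_pickFun (ht : StrictMono t) (ha : ∀ k, 0 < a k) (k : Fin (m + 1)) :
    StrictMonoOn (pickFun t a) (gap t k) := by
  intro u hu v hv huv
  refine (sub_le_sub_left (Finset.sum_le_sum fun i _ => ?_) u).trans_lt (sub_lt_sub_right huv _)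
  rcases gap_subset_Ioi_or_Iio ht k i with h | h
  · exact div_le_div_of_nonneg_left (ha i).le (sub_pos.2 (h u hu)) (sub_le_sub_right huv.le _)
  · have h1 := div_le_div_of_nonneg_left (ha i).le (sub_pos.2 (h v hv))
      (sub_le_sub_left huv.le (t i))
    rw [← neg_sub (t i) v, ← neg_sub (t i) u, div_neg, div_neg]
    exact neg_le_neg h1

lemma continuousOn_pickFun (ht : StrictMono t) (k : Fin (m + 1)) :
    ContinuousOn (pickFun t a) (gap t k) := by
  refine continuousOn_id.sub (continuousOn_finsetSum _ fun i _ => ?_)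
  exact continuousOn_const.div (continuousOn_id.sub continuousOn_const)
    fun u hu => ne_of_mem_gap ht hu i

lemma tendsto_sum_div_sub (s : Finset (Fin m)) {l : Filter ℝ}
    (h : ∀ i, Tendsto (fun u => u - t i) l (Bornology.cobounded ℝ)) :
    Tendsto (fun u => -∑ i ∈ s, a i / (u - t i)) l (𝓝 (-∑ _i ∈ s, 0)) := by
  refine (tendsto_finsetSum _ fun i _ => ?_).neg
  simp_rw [div_eq_mul_inv]
  simpa using (tendsto_inv₀_cobounded.comp (h i)).const_mul (a i)

lemma pickFun_eq_erase (i : Fin m) (u : ℝ) :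
    pickFun t a u = -(a i * (u - t i)⁻¹) + (u - ∑ j ∈ univ.erase i, a j / (u - t j)) := by
  rw [pickFun, ← Finset.add_sum_erase univ _ (mem_univ i), div_eq_mul_inv]
  ring

lemma tendsto_pickFun_erase (ht : StrictMono t) (i : Fin m) :
    Tendsto (fun u => u - ∑ j ∈ univ.erase i, a j / (u - t j)) (𝓝 (t i))
      (𝓝 (t i - ∑ j ∈ univ.erase i, a j / (t i - t j))) := by
  refine tendsto_id.sub (tendsto_finsetSum _ fun j hj => ?_)
  exact tendsto_const_nhds.div (tendsto_id.sub tendsto_const_nhds)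
    (sub_ne_zero.2 (ht.injective.ne (Finset.ne_of_mem_erase hj).symm))

/-- At a finite end the adjacent pole dominates and the rest converges; at -∞ the linear term
dominates and the poles contribute 0. -/
lemma tendsto_pickFun_toLeftEnd (ht : StrictMono t) (ha : ∀ k, 0 < a k) (k : Fin (m + 1)) :
    Tendsto (pickFun t a) (toLeftEnd t k) atBot := by
  have h := tendsto_toLeftEnd (t := t) k
  induction k using Fin.cases with
  | zero =>
    rw [Fin.castSucc_zero, nodes_zero] at h
    replace h := EReal.tendsto_coe_nhds_bot_iff.1 h
    exact h.atBot_add (tendsto_sum_div_sub univ fun i =>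
      (tendsto_atBot_add_const_right _ (-t i) h).mono_right IsOrderBornology.atBot_le_cobounded)
  | succ i =>
    rw [nodes_succ_castSucc] at h
    replace h := EReal.tendsto_coe.1 h
    have h1 : Tendsto (fun u => (u - t i)⁻¹) (toLeftEnd t i.succ) atTop := by
      refine tendsto_inv_nhdsGT_zero.comp (tendsto_nhdsWithin_iff.2 ⟨?_, ?_⟩)
      · simpa using h.sub_const (t i)
      · refine mem_of_superset (inf_le_right (a := comap _ _) (mem_principal_self _)) ?_
        intro u hu
        have := hu.1
        rw [nodes_succ_castSucc, EReal.coe_lt_coe_iff] at this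
        exact sub_pos.2 this
    rw [funext (pickFun_eq_erase i)]
    exact (tendsto_neg_atTop_atBot.comp (h1.const_mul_atTop (ha i))).atBot_add
      ((tendsto_pickFun_erase ht i).comp h)

lemma tendsto_pickFun_toRightEnd (ht : StrictMono t) (ha : ∀ k, 0 < a k) (k : Fin (m + 1)) :
    Tendsto (pickFun t a) (toRightEnd t k) atTop := by
  have h := tendsto_toRightEnd (t := t) k
  induction k using Fin.lastCases with
  | last =>
    rw [Fin.succ_last, nodes_last] at h
    replace h := EReal.tendsto_coe_nhds_top_iff.1 h
    exact h.atTop_add (tendsto_sum_div_sub univ fun i =>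
      (tendsto_atTop_add_const_right _ (-t i) h).mono_right IsOrderBornology.atTop_le_cobounded)
  | cast i =>
    rw [nodes_castSucc_succ] at h
    replace h := EReal.tendsto_coe.1 h
    have h1 : Tendsto (fun u => (u - t i)⁻¹) (toRightEnd t i.castSucc) atBot := by
      refine tendsto_inv_nhdsLT_zero.comp (tendsto_nhdsWithin_iff.2 ⟨?_, ?_⟩)
      · simpa using h.sub_const (t i)
      · refine mem_of_superset (inf_le_right (a := comap _ _) (mem_principal_self _)) ?_
        intro u hu
        have := hu.2
        rw [nodes_castSucc_succ, EReal.coe_lt_coe_iff] at this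
        exact sub_neg.2 this
    rw [funext (pickFun_eq_erase i)]
    exact (tendsto_neg_atBot_atTop.comp (h1.const_mul_atBot (ha i))).atTop_add
      ((tendsto_pickFun_erase ht i).comp h)

lemma exists_pickFun_eq (ht : StrictMono t) (ha : ∀ k, 0 < a k) (k : Fin (m + 1)) (c : ℝ) :
    ∃ u ∈ gap t k, pickFun t a u = c := by
  have : (toLeftEnd t k).NeBot := neBot_toLeftEnd ht k
  have : (toRightEnd t k).NeBot := neBot_toRightEnd ht k
  exact (ordConnected_gap k).isPreconnected.intermediate_value_Iii
    (l₁ := toLeftEnd t k) (l₂ := toRightEnd t k) inf_le_right inf_le_right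
    (continuousOn_pickFun ht k) (tendsto_pickFun_toLeftEnd ht ha k)
    (tendsto_pickFun_toRightEnd ht ha k) (Set.mem_univ c)

/-- The level sets of `pickFun` as functions of the level. -/
lemma exists_inverse_pickFun (ht : StrictMono t) (ha : ∀ k, 0 < a k) (k : Fin (m + 1)) :
    ∃ g : ℝ → ℝ, (∀ c, g c ∈ gap t k) ∧ (∀ c, pickFun t a (g c) = c) ∧
      (∀ u ∈ gap t k, g (pickFun t a u) = u) ∧ StrictMono g ∧ Continuous g ∧
      Tendsto (fun c => (g c : EReal)) atBot (𝓝 (nodes t k.castSucc)) ∧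
      Tendsto (fun c => (g c : EReal)) atTop (𝓝 (nodes t k.succ)) := by
  choose g hg hgc using exists_pickFun_eq ht ha k
  have hmono := strictMonoOn_pickFun ht ha k
  have hinv : ∀ u ∈ gap t k, g (pickFun t a u) = u := fun u hu =>
    hmono.injOn (hg _) hu (hgc _)
  have hgm : StrictMono g := fun c c' h => by
    rw [← hmono.lt_iff_lt (hg c) (hg c'), hgc, hgc]
    exact h
  have hrange : Set.range g = gap t k := by
    refine Set.Subset.antisymm ?_ fun u hu => ⟨_, hinv u hu⟩
    rintro _ ⟨c, rfl⟩
    exact hg c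
  -- A strictly increasing function whose range is an interval has no jumps, hence is continuous.
  have : (Set.range g).OrdConnected := hrange ▸ ordConnected_gap k
  refine ⟨g, hg, hgc, hinv, hgm, (hgm.isEmbedding_of_ordConnected this).continuous, ?_, ?_⟩
  · refine tendsto_order.2 ⟨fun b hb => Eventually.of_forall fun c => hb.trans (hg c).1,
      fun b hb => ?_⟩
    obtain ⟨y, hy, hyb⟩ := exists_mem_gap_lt ht k hb
    filter_upwards [eventually_lt_atBot (pickFun t a y)] with c hc
    refine lt_trans (EReal.coe_lt_coe_iff.2 ?_) hyb
    rw [← hinv y hy]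
    exact hgm hc
  · refine tendsto_order.2 ⟨fun b hb => ?_,
      fun b hb => Eventually.of_forall fun c => (hg c).2.trans hb⟩
    obtain ⟨y, hy, hyb⟩ := exists_mem_gap_gt ht k hb
    filter_upwards [eventually_gt_atTop (pickFun t a y)] with c hc
    refine lt_trans hyb (EReal.coe_lt_coe_iff.2 ?_)
    rw [← hinv y hy]
    exact hgm hc

end Pick

/-! ### Level sets of the Pick function are equilibria. -/

section LevelSets

variable {m : ℕ} {ζ : Fin m → UpperHalfPlane} {t : Fin m → ℝ}

/-- The residues of the Pick function attached to the points `t`. -/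
noncomputable def residue (ζ : Fin m → UpperHalfPlane) (t : Fin m → ℝ) (k : Fin m) : ℝ :=
  (fieldPoly ζ).eval (t k) / (cofactor t k).eval (t k) ^ 2

lemma residue_pos (ht : Function.Injective t) (k : Fin m) : 0 < residue ζ t k :=
  div_pos (eval_fieldPoly_pos ζ _) (sq_pos_of_ne_zero (eval_cofactor_self_ne_zero ht k))

/-- The numerator of `pickFun t a - c`. -/
noncomputable def levelPoly (t a : Fin m → ℝ) (c : ℝ) : ℝ[X] :=
  X * Lagrange.nodal univ t - (∑ k, C (a k) * cofactor t k + C c * Lagrange.nodal univ t)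

lemma monic_levelPoly (t a : Fin m → ℝ) (c : ℝ) :
    (levelPoly t a c).Monic ∧ (levelPoly t a c).degree = ((m + 1 : ℕ) : WithBot ℕ) := by
  have hP : (X * Lagrange.nodal univ t).Monic := monic_X.mul Lagrange.nodal_monic
  have hd : (X * Lagrange.nodal univ t).degree = ((m + 1 : ℕ) : WithBot ℕ) := by
    rw [degree_mul, degree_X, Lagrange.degree_nodal]
    simp [add_comm]
  have hlt : (∑ k, C (a k) * cofactor t k + C c * Lagrange.nodal univ t).degree
      < (X * Lagrange.nodal univ t).degree := by
    rw [hd]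
    have hm : ((m : ℕ) : WithBot ℕ) < ((m + 1 : ℕ) : WithBot ℕ) := by
      exact_mod_cast m.lt_succ_self
    refine lt_of_le_of_lt ?_ hm
    refine (degree_add_le _ _).trans (max_le ?_ ?_)
    · refine (degree_sum_le _ _).trans (Finset.sup_le fun k _ => ?_)
      refine (smul_eq_C_mul (R := ℝ) _ ▸ degree_smul_le _ _).trans ?_
      rw [cofactor, Lagrange.degree_nodal]
      exact_mod_cast (Finset.card_le_univ _).trans_eq (Fintype.card_fin m)
    · refine (smul_eq_C_mul (R := ℝ) _ ▸ degree_smul_le _ _).trans ?_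
      rw [Lagrange.degree_nodal]
      simp
  exact ⟨hP.sub_of_left hlt, (degree_sub_eq_left_of_degree_lt hlt).trans hd⟩

lemma eval_levelPoly {u : ℝ} (a : Fin m → ℝ) (c : ℝ) (hu : ∀ i, u - t i ≠ 0) :
    (levelPoly t a c).eval u = (Lagrange.nodal univ t).eval u * (pickFun t a u - c) := by
  have h : ∀ k, a k * (cofactor t k).eval u
      = (Lagrange.nodal univ t).eval u * (a k / (u - t k)) := by
    intro k
    rw [nodal_eq_mul_cofactor t k]
    have := hu k
    simp
    field_simp
  simp only [levelPoly, eval_sub, eval_mul, eval_X, eval_add, eval_finsetSum, eval_C, pickFun, h,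
    ← Finset.mul_sum]
  ring

/-- The Wronskian of X N and N is N², that of N with itself is 0, and each cofactor contributes its
own square because N = (X - t_k) · cofactor. The residues are chosen so that the total is the
sum-of-squares form of F. -/
lemma wronskian_levelPoly (ht : Function.Injective t) (h : IsEquilibrium ζ t) (c : ℝ) :
    derivative (levelPoly t (residue ζ t) c) * Lagrange.nodal univ t
      - levelPoly t (residue ζ t) c * derivative (Lagrange.nodal univ t) = fieldPoly ζ := by
  have hk : ∀ k, C (residue ζ t k) * (cofactor t k * derivative (Lagrange.nodal univ t)
      - derivative (cofactor t k) * Lagrange.nodal univ t)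
      = C ((fieldPoly ζ).eval (t k)) * basisPoly t k ^ 2 := by
    intro k
    rw [basisPoly_eq t, nodal_eq_mul_cofactor t k, residue, div_eq_mul_inv, C_mul, ← inv_pow,
      C_pow]
    simp only [derivative_mul, derivative_sub, derivative_X, derivative_C]
    ring
  conv_rhs => rw [fieldPoly_eq_sq_add_sum ht h, Finset.sum_congr rfl fun k _ => (hk k).symm]
  simp only [levelPoly, derivative_sub, derivative_add, derivative_mul, derivative_X,
    derivative_sum, derivative_C, mul_sub, Finset.sum_sub_distrib, zero_mul, zero_add, one_mul]
  simp only [← mul_assoc, ← Finset.sum_mul]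
  ring

lemma isEquilibrium_of_pickFun_eq (ht : StrictMono t) (h : IsEquilibrium ζ t) {c : ℝ}
    {x : Fin (m + 1) → ℝ} (hx : ∀ k, x k ∈ gap t k)
    (hc : ∀ k, pickFun t (residue ζ t) (x k) = c) : IsEquilibrium ζ x := by
  have hxi := injective_of_mem_gap ht hx
  set R := levelPoly t (residue ζ t) c with hR
  obtain ⟨hRm, hRd⟩ := monic_levelPoly t (residue ζ t) c
  have hdeg : (Lagrange.nodal univ x).degree = ((m + 1 : ℕ) : WithBot ℕ) := by
    simp [Lagrange.degree_nodal]
  -- Both are monic of degree m + 1 and vanish at the m + 1 distinct points of x.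
  have hRx : R = Lagrange.nodal univ x := by
    refine Polynomial.eq_of_degree_sub_lt_of_eval_index_eq univ hxi.injOn ?_ fun k hk => ?_
    · rw [card_univ, Fintype.card_fin, ← hRd]
      exact degree_sub_lt_left (hRd.trans hdeg.symm) hRm.ne_zero
        (hRm.leadingCoeff.trans Lagrange.nodal_monic.leadingCoeff.symm)
    · rw [Lagrange.eval_nodal_at_node hk, hR,
        eval_levelPoly _ _ fun i => ne_of_mem_gap ht (hx k) i, hc, sub_self, mul_zero]
  have hW := wronskian_levelPoly ht.injective h c
  rw [← hR] at hW
  refine (isEquilibrium_iff hxi).2 fun k => ?_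
  have hRk : R = (X - C (x k)) * cofactor x k := hRx.trans (nodal_eq_mul_cofactor x k)
  -- At `x k`, with C the cofactor, R = 0, R' = C and R'' = 2C'. The Wronskian identity and its
  -- derivative give F = C N and F' = 2 C' N, hence 2 C' F = C F'.
  rw [← hW, hRk]
  simp
  ring

end LevelSets

end BlaschkeEquilibrium

/-! ### Assembly of the theorem. -/

open BlaschkeEquilibrium in
theorem theorem2 (m : ℕ) (hm : 1 ≤ m) (ζ : Fin m → UpperHalfPlane) :
    ∃ t : Fin m → ℝ,
      -- part (i): the unique ordered solution
      (StrictMono t ∧ BlaschkeEquilibrium.IsEquilibrium ζ t) ∧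
      (∀ t' : Fin m → ℝ, StrictMono t' → BlaschkeEquilibrium.IsEquilibrium ζ t' → t' = t) ∧
      -- it realizes the global minimum of the energy, alone up to rearrangement
      IsMinOn (BlaschkeEquilibrium.energy ζ) (BlaschkeEquilibrium.configurations m) t ∧
      (∀ s ∈ BlaschkeEquilibrium.configurations m,
        IsMinOn (BlaschkeEquilibrium.energy ζ) (BlaschkeEquilibrium.configurations m) s →
          ∃ σ : Equiv.Perm (Fin m), s = t ∘ σ) ∧
      -- the critical points of the energy are exactly its rearrangements
      (∀ s : Fin m → ℝ, BlaschkeEquilibrium.IsCriticalPoint ζ s ↔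
        ∃ σ : Equiv.Perm (Fin m), s = t ∘ σ) ∧
      -- part (ii)
      (∀ k₀ : Fin (m + 1), ∃ X : ℝ → Fin (m + 1) → ℝ,
        (∀ u ∈ BlaschkeEquilibrium.gap t k₀,
          (X u k₀ = u ∧ BlaschkeEquilibrium.IsInterlacingSolution ζ t (X u)) ∧
          ∀ x : Fin (m + 1) → ℝ, x k₀ = u →
            BlaschkeEquilibrium.IsInterlacingSolution ζ t x → x = X u) ∧
        ∀ k : Fin (m + 1),
          ContinuousOn (fun u => X u k) (BlaschkeEquilibrium.gap t k₀) ∧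
          StrictMonoOn (fun u => X u k) (BlaschkeEquilibrium.gap t k₀) ∧
          Tendsto (fun u => (X u k : EReal)) (BlaschkeEquilibrium.toLeftEnd t k₀)
            (𝓝 (BlaschkeEquilibrium.nodes t k.castSucc)) ∧
          Tendsto (fun u => (X u k : EReal)) (BlaschkeEquilibrium.toRightEnd t k₀)
            (𝓝 (BlaschkeEquilibrium.nodes t k.succ))) := by
  obtain ⟨s, hs, hmin⟩ := exists_isMinOn_energy ζ
  obtain ⟨τ, ht⟩ := exists_strictMono_comp_perm hs
  have heq : IsEquilibrium ζ (s ∘ τ) := (isEquilibrium_of_isMinOn ζ hs hmin).comp_perm τ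
  set t := s ∘ τ with ht_def
  refine ⟨t, ⟨ht, heq⟩, fun t' h1 h2 => heq.eq_of_strictMono ht h1 h2, fun r hr => ?_,
    fun r hr hrmin => heq.exists_perm ht hr (isEquilibrium_of_isMinOn ζ hr hrmin), fun r => ?_,
    fun k₀ => ?_⟩
  · have : energy ζ s ≤ energy ζ r := hmin hr
    rwa [← energy_comp_perm ζ s τ] at this
  · rw [isCriticalPoint_iff]
    constructor
    · rintro ⟨h1, h2⟩
      exact heq.exists_perm ht h1 h2
    · rintro ⟨σ, rfl⟩
      exact ⟨ht.injective.comp σ.injective, heq.comp_perm σ⟩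
  have ha := residue_pos (ζ := ζ) ht.injective
  choose g hg hgc hinv hgm hgcont hbot htop using exists_inverse_pickFun ht ha
  -- The solution through u consists of the points, one per gap, at which the Pick function takes
  -- the same value as at u.
  refine ⟨fun u k => g k (pickFun t (residue ζ t) u), fun u hu => ?_, fun k => ⟨?_, ?_, ?_, ?_⟩⟩
  · have hX : IsInterlacingSolution ζ t fun k => g k (pickFun t (residue ζ t) u) :=
      ⟨fun k => hg k _, isEquilibrium_of_pickFun_eq ht heq (fun k => hg k _) fun k => hgc k _⟩
    refine ⟨⟨hinv k₀ u hu, hX⟩, fun x hxu hx => funext fun k => ?_⟩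
    -- Sharing the point u, the two equilibria share all points; disjointness of the gaps then
    -- matches the indices.
    obtain ⟨j, hj⟩ := hx.2.exists_eq_of_common (injective_of_mem_gap ht hx.1)
      (injective_of_mem_gap ht hX.1) hX.2 (hxu.trans (hinv k₀ u hu).symm) k
    have hjk : x k ∈ gap t j := by
      rw [← hj]
      exact hX.1 j
    rw [← hj, eq_of_mem_gap ht hjk (hx.1 k)]
  · exact (hgcont k).comp_continuousOn (continuousOn_pickFun ht k₀)
  · exact fun u hu v hv huv => hgm k (strictMonoOn_pickFun ht ha k₀ hu hv huv)
  · exact (hbot k).comp (tendsto_pickFun_toLeftEnd ht ha k₀)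
  · exact (htop k).comp (tendsto_pickFun_toRightEnd ht ha k₀)
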